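/- Let $m\ge 2$ and $n=2^m+1$; indices $i$ are taken modulo $n$. Put $\alpha=\frac{1}{2\cos(\pi/n)}$, $\bar\alpha=\frac{1+2\alpha}{1-2\alpha}$, $\phi_k=\frac{n-1}{n}\pi k$, $\beta_k=\frac{1}{2(1-\cos\phi_k)}$, $$c_1=\frac{2^{2m-3}}{\bar\alpha^2}\,\frac{1}{2^{2m-1}\beta_1(1-2\beta_1)+\beta_1^2\prod_{j=1}^{m-1}\sec\phi_{2^j}},\qquad c_{2^x}=c_1\Big(\frac{\beta_1}{2^x\beta_{2^x}}\Big)^2\prod_{j=1}^{x}\sec\phi_{2^j}\quad(0\le x\le m-1),$$ and $c_k=0$ for all other $k$; further $\gamma=-2\bar\alpha\sum_k c_k$ and $\eta_n=n\bar\alpha^2\sum_k c_k\big(\frac{1}{\bar\alpha^2}+1+6\beta_k^2-4\beta_k\big)$. Consider $n$ two-outcome measurements on a finite-dimensional complex Hilbert space $\mathcal H$, the $i$-th one given by Kraus operators $K_i$ (outcome $+$) and $K_i'$ (outcome $-$) with $K_i^\dagger K_i+K_i'^\dagger K_i'=\mathbb 1$. Let $F_i=K_i^\dagger K_i$ and $A_i=2F_i-\mathbb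 1$, and assume that $K_i=\sqrt{F_i}$ for all $i$. The modified $n$-cycle operator is $$\tilde B_n=-\tfrac12\sum_i\{A_i,A_{i+1}\}-\gamma\sum_iA_i-\sum_i(K_iK_{i+1})^\dagger(K_iK_{i+1})-\sum_i(K_iK_{i-1})^\dagger(K_iK_{i-1}),$$ and its quantum value in a unit vector $|\psi\rangle$ is $\langle\psi|\tilde B_n|\psi\rangle$; here $\langle\psi|(K_iK_{i\pm1})^\dagger(K_iK_{i\pm1})|\psi\rangle=p(++|\mathcal A_{i\pm1},\mathcal A_i)$ is the probability of obtaining $+$ twice when $\mathcal A_{i\pm1}$ is measured first and $\mathcal A_i$ second. Then $\eta_n$ is the maximum of $\langle\psi|\tilde B_n|\psi\rangle$ over all such measurements and unit vectors, in all finite dimensions. Moreover, this maximum self-tests the state and the measurements: if $|\psi\rangle\in\mathcal H$ is a unit vector and the measurements on $\mathcal H$ are as above with $\langle\psi|\tilde B_n|\psi\rangle=\eta_n$, then there are a projection $P:\mathcal H\to\mathbb C^3$ (a linear map with $PP^\dagger=\mathbb 1_3$) and a unitary $U$ on $\mathbb C^3$ such that $$U(PA_iP^\dagger)U^\dagger=2|\hat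 v_i\rangle\langle\hat v_i|-\mathbb 1_3\quad(i=1,\dots,n),\qquad U(P|\psi\rangle)=(1,0,0)^T,$$ where $|\hat v_i\rangle=(\cos\theta,\ \sin\theta\sin\phi_i,\ \sin\theta\cos\phi_i)^T$ with $\theta\in[0,\pi/2]$ and $\cos\theta=\sqrt{1/(1+2\alpha)}$. -/

import Mathlib

noncomputable section

namespace KCBS

/-! ### Two-outcome quantum measurements -/

/-- A two-outcome (`±1`) quantum measurement on a Hilbert space `H`: Kraus operators `K` (outcome
`+1`) and `K'` (outcome `-1`) with `K† K + K'† K' = 1`. In particular `F = K† K ≤ 1` and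
`K'† K' = 1 - F`. -/
structure BinaryMeasurement (H : Type*) [NormedAddCommGroup H] [InnerProductSpace ℂ H]
    [CompleteSpace H] where
  /-- Kraus operator of the outcome `+1`. -/
  K : H →L[ℂ] H
  /-- Kraus operator of the outcome `-1`. -/
  K' : H →L[ℂ] H
  complete : star K * K + star K' * K' = 1

section Measurement

variable {H : Type*} [NormedAddCommGroup H] [InnerProductSpace ℂ H] [CompleteSpace H]

/-- The effect `F = K† K` of the outcome `+1`. -/
def BinaryMeasurement.effect (M : BinaryMeasurement H) : H →L[ℂ] H := star M.K * M.K

/-- The operator `A = 2 F - 1` that represents the measurement. -/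
def BinaryMeasurement.obs (M : BinaryMeasurement H) : H →L[ℂ] H := (2 : ℂ) • M.effect - 1

/-- The outcome `+1` is realized by the Lüders rule: `K = √F`. -/
def BinaryMeasurement.IsLuders (M : BinaryMeasurement H) : Prop := M.K = CFC.sqrt M.effect

end Measurement

/-! ### The constants, for a cycle of length `n` -/

/-- `α = (1/2) sec (π / n)`. -/
def alpha (n : ℕ) : ℝ := 1 / (2 * Real.cos (Real.pi / n))

/-- `ᾱ = (1 + 2 α) / (1 - 2 α)`. -/
def alphaBar (n : ℕ) : ℝ := (1 + 2 * alpha n) / (1 - 2 * alpha n)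

/-- `φ_k = ((n - 1) / n) π k`. -/
def phi (n k : ℕ) : ℝ := ((n : ℝ) - 1) / n * Real.pi * k

/-- `β_k = 1 / (2 (1 - cos φ_k))`. -/
def beta (n k : ℕ) : ℝ := 1 / (2 * (1 - Real.cos (phi n k)))

/-- `∏_{j=1}^{x} sec φ_{2^j}`. -/
def secProd (n x : ℕ) : ℝ := ∏ j ∈ Finset.Icc 1 x, (Real.cos (phi n (2 ^ j)))⁻¹

/-- The cycle length `n = 2^m + 1`. -/
abbrev cyc (m : ℕ) : ℕ := 2 ^ m + 1

/-- The coefficient `c_1`, for `n = 2^m + 1` (used for `m ≥ 2`). -/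
def cOne (m : ℕ) : ℝ :=
  2 ^ (2 * m - 3) / alphaBar (cyc m) ^ 2 *
    (1 / (2 ^ (2 * m - 1) * beta (cyc m) 1 * (1 - 2 * beta (cyc m) 1)
      + beta (cyc m) 1 ^ 2 * secProd (cyc m) (m - 1)))

/-- The coefficient `c_{2^x}`, for `0 ≤ x ≤ m - 1` and `n = 2^m + 1`. All other `c_k` are zero, so
that a sum over `k` is a sum over `k = 2^x` with `x = 0, …, m - 1`. -/
def cPow (m x : ℕ) : ℝ :=
  cOne m * (beta (cyc m) 1 / (2 ^ x * beta (cyc m) (2 ^ x))) ^ 2 * secProd (cyc m) x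

/-- `γ = - 2 ᾱ ∑_k c_k`. -/
def gam (m : ℕ) : ℝ := -2 * alphaBar (cyc m) * ∑ x ∈ Finset.range m, cPow m x

/-- `η_n = n ᾱ² ∑_k c_k (1 / ᾱ² + 1 + 6 β_k² - 4 β_k)`, for `n = 2^m + 1`. -/
def eta (m : ℕ) : ℝ :=
  (cyc m : ℝ) * alphaBar (cyc m) ^ 2 *
    ∑ x ∈ Finset.range m, cPow m x *
      (1 / alphaBar (cyc m) ^ 2 + 1 + 6 * beta (cyc m) (2 ^ x) ^ 2 - 4 * beta (cyc m) (2 ^ x))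

/-! ### The operators `B_n` and `B̃_n`

The settings are indexed by `ZMod n`, so that `i ± 1` is taken modulo `n`. -/

section Operators

variable {H : Type*} [NormedAddCommGroup H] [InnerProductSpace ℂ H] [CompleteSpace H]

/-- `B_n = - (1/2) ∑_i {A_i, A_{i+1}} - γ ∑_i A_i`. -/
def opB (m : ℕ) (M : ZMod (cyc m) → BinaryMeasurement H) : H →L[ℂ] H :=
  -((1 / 2 : ℂ) • ∑ i, ((M i).obs * (M (i + 1)).obs + (M (i + 1)).obs * (M i).obs))
    - (gam m : ℂ) • ∑ i, (M i).obs

/-- `B̃_n = B_n - ∑_i (K_i K_{i+1})† (K_i K_{i+1}) - ∑_i (K_i K_{i-1})† (K_i K_{i-1})`. The expectation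
of `(K_i K_j)† (K_i K_j)` in the state `ψ` is the probability `p(++ | A_j, A_i) = ‖K_i K_j ψ‖²` of
obtaining `+` twice when `A_j` is measured first and then `A_i`. -/
def opBTilde (m : ℕ) (M : ZMod (cyc m) → BinaryMeasurement H) : H →L[ℂ] H :=
  opB m M
    - ∑ i, star ((M i).K * (M (i + 1)).K) * ((M i).K * (M (i + 1)).K)
    - ∑ i, star ((M i).K * (M (i - 1)).K) * ((M i).K * (M (i - 1)).K)

/-- The quantum value `⟨ψ| B̃_n |ψ⟩` (a real number, as `B̃_n` is self-adjoint). -/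
def value (m : ℕ) (M : ZMod (cyc m) → BinaryMeasurement H) (ψ : H) : ℝ :=
  (inner ℂ ψ (opBTilde m M ψ)).re

end Operators

/-- All quantum values of the expression `B̃_n`, over unit vectors and Lüders-type measurements on
Hilbert spaces of arbitrary finite dimension `d`. -/
def quantumValues (m : ℕ) : Set ℝ :=
  {r | ∃ (d : ℕ) (M : ZMod (cyc m) → BinaryMeasurement (EuclideanSpace ℂ (Fin d)))
    (ψ : EuclideanSpace ℂ (Fin d)), (∀ i, (M i).IsLuders) ∧ ‖ψ‖ = 1 ∧ value m M ψ = r}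

/-! ### The reference vectors in `ℂ³` -/

/-- The angle `θ ∈ [0, π/2]` with `cos θ = √(1 / (1 + 2 α))`. -/
def theta (n : ℕ) : ℝ := Real.arccos (Real.sqrt (1 / (1 + 2 * alpha n)))

/-- `v̂_i = (cos θ, sin θ sin φ_i, sin θ cos φ_i)ᵀ`. For odd `n` it depends on `i` modulo `n` only,
and so it is evaluated at the representative of `i` in `{0, …, n - 1}`. -/
def vHat (n : ℕ) (i : ZMod n) : EuclideanSpace ℂ (Fin 3) :=
  !₂[(Real.cos (theta n) : ℂ),
    (Real.sin (theta n) * Real.sin (phi n i.val) : ℝ),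
    (Real.sin (theta n) * Real.cos (phi n i.val) : ℝ)]

/-- The reference state `(1, 0, 0)ᵀ`. -/
def psiHat : EuclideanSpace ℂ (Fin 3) := !₂[1, 0, 0]

/-- The reference observable `2 |v̂_i⟩⟨v̂_i| - 1`. -/
def obsHat (n : ℕ) (i : ZMod n) : EuclideanSpace ℂ (Fin 3) →L[ℂ] EuclideanSpace ℂ (Fin 3) :=
  (2 : ℂ) • InnerProductSpace.rankOne ℂ (vHat n i) (vHat n i) - 1

end KCBS

end

/-!
# Self-testing with the modified `n`-cycle operator

*The bound.* Write `a i = A_i ψ`. In the reference configuration `ψ` is fixed by each operator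
`ᾱ ((1 - 2 β_k) A_{i+k} + β_k (A_{i+2k} + A_i))`; `stab` is the image of `ψ` under it, for `k = 2^x`.
The sum over `i` of the squared distances from these images to `ψ` involves only the correlations
`corr a k` and `corr a (2 k)`, the mean values of the `A_i`, and the norms of the `a i`. The
coefficients `c_k` are such that in the weighted sum over `k = 1, 2, 4, …, 2^(m-1)` each correlation
produced by one `k` is cancelled by the next one (`cPow_cancel`). The last one, at distance
`2^m ≡ -1`, is a nearest-neighbour correlation again, and `c_1` normalizes the total
(`cPow_normalization`). Hence `η_n - ⟨ψ| B̃_n |ψ⟩` is a sum with nonnegative weights of these squared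
distances, of the defects `1 - ‖A_i ψ‖² = 4 ‖K_i' K_i ψ‖²`, and of the probabilities
`‖K_i K_{i±1} ψ‖²` (`eta_sub_value`). All terms vanish for the reference configuration, so `η_n` is
attained (`value_refMeasurement`).

*Rigidity.* At the maximum every term vanishes. Then `w i = K_i ψ` satisfies
`F_i ψ = F_i (w i) = w i` and `F_i (w (i + 1)) = 0`, and the relation for `k = 1` reads
`w (i + 2) + w i = 2 cos (π / n) (ψ - w (i + 1))` (`optimalRelations_of_value_eq_eta`). This
three-term recurrence confines all `w i` to the span of `ψ, w 0, w 1`. Pairing it with its outer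
vectors gives `‖w (i + 2)‖ = ‖w i‖`, so that, `n` being odd, all norms agree, and pairing it with `ψ`
gives `‖w i‖² = cos² θ` (`OptimalRelations.inner_self`). The Gram matrix of `ψ, w 0, w 1` is therefore
that of `(1, 0, 0)ᵀ, cos θ v̂_0, cos θ v̂_1`, and the recurrence, which is the addition theorem for
angles `φ_i`, propagates this to all `i` (`OptimalRelations.exists_isometry`). The adjoint of the
resulting isometry `ℂ³ → H` is the required `P`, with `U = 1`; it intertwines `F_i` with
`|v̂_i⟩⟨v̂_i|` by `OptimalRelations.apply_isometry`.
-/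

noncomputable section

namespace KCBS

/-! ### The constants -/

theorem cos_phi_of_even {n k : ℕ} (hn : n ≠ 0) (hk : Even k) :
    Real.cos (phi n k) = Real.cos (Real.pi * k / n) := by
  obtain ⟨r, rfl⟩ := hk
  have hn' : (n : ℝ) ≠ 0 := by exact_mod_cast hn
  have h : phi n (r + r) = r * (2 * Real.pi) - Real.pi * ((r + r : ℕ) : ℝ) / n := by
    unfold phi; push_cast; field_simp; ring
  rw [h, Real.cos_nat_mul_two_pi_sub]

theorem phi_one {n : ℕ} (hn : n ≠ 0) : phi n 1 = Real.pi - Real.pi / n := by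
  have hn' : (n : ℝ) ≠ 0 := by exact_mod_cast hn
  unfold phi; push_cast; field_simp

theorem cos_phi_one {n : ℕ} (hn : n ≠ 0) : Real.cos (phi n 1) = -Real.cos (Real.pi / n) := by
  rw [phi_one hn, Real.cos_pi_sub]

theorem phi_add (n j k : ℕ) : phi n (j + k) = phi n j + phi n k := by
  unfold phi; push_cast; ring

theorem half_lt_cos {n : ℕ} (hn : 5 ≤ n) : 1 / 2 < Real.cos (Real.pi / n) := by
  have hn' : (5 : ℝ) ≤ n := by exact_mod_cast hn
  rw [← Real.cos_pi_div_three]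
  have := Real.pi_pos
  apply Real.cos_lt_cos_of_nonneg_of_le_pi (by positivity) (by linarith)
  apply div_lt_div_of_pos_left this (by norm_num) (by linarith)

theorem cos_lt_one {n : ℕ} (hn : 5 ≤ n) : Real.cos (Real.pi / n) < 1 := by
  rw [← Real.cos_zero]
  have := Real.pi_pos
  have hn' : (5 : ℝ) ≤ n := by exact_mod_cast hn
  exact Real.cos_lt_cos_of_nonneg_of_le_pi le_rfl (div_le_self this.le (by linarith))
    (by positivity)

theorem sin_phi_one_pos {n : ℕ} (hn : 5 ≤ n) : 0 < Real.sin (phi n 1) := by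
  have hn' : (5 : ℝ) ≤ n := by exact_mod_cast hn
  rw [phi_one (by omega), Real.sin_pi_sub]
  have := Real.pi_pos
  apply Real.sin_pos_of_pos_of_lt_pi (by positivity)
  exact div_lt_self this (by linarith)

theorem cyc_ne_zero (m : ℕ) : cyc m ≠ 0 := Nat.succ_ne_zero _

theorem five_le_cyc {m : ℕ} (hm : 2 ≤ m) : 5 ≤ cyc m := by
  have : 2 ^ 2 ≤ 2 ^ m := Nat.pow_le_pow_right (by norm_num) hm
  unfold cyc; omega

theorem cos_phi_two_pow_pos {m x : ℕ} (hx : 1 ≤ x) (hxm : x < m) :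
    0 < Real.cos (phi (cyc m) (2 ^ x)) := by
  rw [cos_phi_of_even (cyc_ne_zero m) ((Nat.even_pow' (by omega)).2 even_two)]
  have := Real.pi_pos
  have h1 : (2 : ℕ) ^ x * 2 ≤ 2 ^ m := by
    rw [← pow_succ]; exact Nat.pow_le_pow_right (by norm_num) (by omega)
  have h2 : ((2 ^ x : ℕ) : ℝ) * 2 < (cyc m : ℕ) := by
    exact_mod_cast (by unfold cyc; omega : 2 ^ x * 2 < cyc m)
  have h3 : (0 : ℝ) < (cyc m : ℕ) := by unfold cyc; positivity
  apply Real.cos_pos_of_mem_Ioo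
  constructor
  · have : 0 ≤ Real.pi * ((2 ^ x : ℕ) : ℝ) / (cyc m : ℕ) := by positivity
    linarith
  · rw [div_lt_div_iff₀ h3 (by norm_num)]
    nlinarith

theorem cos_phi_two_pow_lt_one {m x : ℕ} (hm : 2 ≤ m) (hxm : x < m) :
    Real.cos (phi (cyc m) (2 ^ x)) < 1 := by
  rcases Nat.eq_zero_or_pos x with rfl | hx
  · have := half_lt_cos (five_le_cyc hm)
    rw [pow_zero, cos_phi_one (cyc_ne_zero m)]; linarith
  · have hn : (0 : ℝ) < (cyc m : ℕ) := by unfold cyc; positivity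
    rw [cos_phi_of_even (cyc_ne_zero m) ((Nat.even_pow' (by omega)).2 even_two),
      ← Real.cos_zero]
    have := Real.pi_pos
    have h1 : (2 : ℕ) ^ x ≤ 2 ^ m := Nat.pow_le_pow_right (by norm_num) (by omega)
    have h2 : ((2 ^ x : ℕ) : ℝ) ≤ (cyc m : ℕ) := by
      exact_mod_cast (by unfold cyc; omega : 2 ^ x ≤ cyc m)
    apply Real.cos_lt_cos_of_nonneg_of_le_pi le_rfl
    · rw [div_le_iff₀ hn]; nlinarith
    · have : (0 : ℝ) < ((2 ^ x : ℕ) : ℝ) := by positivity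
      positivity

theorem beta_pos {m x : ℕ} (hm : 2 ≤ m) (hxm : x < m) : 0 < beta (cyc m) (2 ^ x) := by
  have := cos_phi_two_pow_lt_one hm hxm
  unfold beta
  apply div_pos one_pos; linarith

theorem two_mul_beta_mul {m x : ℕ} (hm : 2 ≤ m) (hxm : x < m) :
    2 * beta (cyc m) (2 ^ x) * (1 - Real.cos (phi (cyc m) (2 ^ x))) = 1 := by
  have := cos_phi_two_pow_lt_one hm hxm
  have : 1 - Real.cos (phi (cyc m) (2 ^ x)) ≠ 0 := by linarith
  unfold beta; field_simp

theorem one_sub_two_mul_beta {m x : ℕ} (hm : 2 ≤ m) (hxm : x < m) :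
    1 - 2 * beta (cyc m) (2 ^ x) =
      -(2 * beta (cyc m) (2 ^ x) * Real.cos (phi (cyc m) (2 ^ x))) := by
  have := two_mul_beta_mul hm hxm
  linarith

theorem two_mul_alpha {n : ℕ} (hn : 5 ≤ n) : 2 * alpha n * Real.cos (Real.pi / n) = 1 := by
  have := half_lt_cos hn
  have : Real.cos (Real.pi / n) ≠ 0 := by linarith
  unfold alpha; field_simp

/-- `ᾱ⁻¹ = 2 cos² θ - 1`, where `cos² θ = c / (1 + c)` with `c = cos (π / n)`. -/
theorem alphaBar_eq {n : ℕ} (hn : 5 ≤ n) :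
    alphaBar n = (Real.cos (Real.pi / n) + 1) / (Real.cos (Real.pi / n) - 1) := by
  have h := half_lt_cos hn
  have h1 := cos_lt_one hn
  have h0 : Real.cos (Real.pi / n) ≠ 0 := by linarith
  have h2 := two_mul_alpha hn
  have h3 : 2 * alpha n = 1 / Real.cos (Real.pi / n) := by field_simp; linarith
  have h4 : Real.cos (Real.pi / n) - 1 ≠ 0 := by linarith
  unfold alphaBar
  rw [h3]
  field_simp

theorem alphaBar_ne_zero {n : ℕ} (hn : 5 ≤ n) : alphaBar n ≠ 0 := by
  have h := half_lt_cos hn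
  have h2 := two_mul_alpha hn
  have h1 := cos_lt_one hn
  rw [alphaBar_eq hn]
  apply div_ne_zero <;> linarith

theorem secProd_pos {m x : ℕ} (hxm : x < m) : 0 < secProd (cyc m) x := by
  apply Finset.prod_pos
  intro j hj
  rw [Finset.mem_Icc] at hj
  exact inv_pos.2 (cos_phi_two_pow_pos hj.1 (by omega))

theorem cOne_denominator_pos {m : ℕ} (hm : 2 ≤ m) :
    0 < 2 ^ (2 * m - 1) * beta (cyc m) 1 * (1 - 2 * beta (cyc m) 1)
      + beta (cyc m) 1 ^ 2 * secProd (cyc m) (m - 1) := by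
  have hb := beta_pos hm (show 0 < m by omega)
  have h1 := one_sub_two_mul_beta hm (show 0 < m by omega)
  rw [pow_zero] at hb h1
  have hc := half_lt_cos (five_le_cyc hm)
  rw [cos_phi_one (cyc_ne_zero m)] at h1
  have h2 : 0 < 1 - 2 * beta (cyc m) 1 := by
    rw [h1]
    have : 0 < beta (cyc m) 1 * Real.cos (Real.pi / (cyc m : ℕ)) := mul_pos hb (by linarith)
    linarith
  have h3 := secProd_pos (show m - 1 < m by omega)
  positivity

theorem cOne_pos {m : ℕ} (hm : 2 ≤ m) : 0 < cOne m := by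
  have h1 := cOne_denominator_pos hm
  have h2 := alphaBar_ne_zero (five_le_cyc hm)
  unfold cOne
  positivity

theorem cPow_pos {m x : ℕ} (hm : 2 ≤ m) (hxm : x < m) : 0 < cPow m x := by
  have h1 := cOne_pos hm
  have h2 := secProd_pos hxm
  have h3 := beta_pos hm hxm
  have h4 := beta_pos hm (show 0 < m by omega)
  rw [pow_zero] at h4
  unfold cPow
  positivity

theorem cPow_zero {m : ℕ} (hm : 2 ≤ m) : cPow m 0 = cOne m := by
  have h4 := beta_pos hm (show 0 < m by omega)
  rw [pow_zero] at h4
  unfold cPow secProd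
  simp [h4.ne']

theorem cPow_mul_beta_sq {m x : ℕ} (hm : 2 ≤ m) (hxm : x < m) :
    cPow m x * beta (cyc m) (2 ^ x) ^ 2 =
      cOne m * (beta (cyc m) 1 / 2 ^ x) ^ 2 * secProd (cyc m) x := by
  have h3 := beta_pos hm hxm
  unfold cPow
  field_simp

/-- The correlation at distance `2^(x+1)` receives opposite contributions from the stabilizing
relations with `k = 2^x` and with `k = 2^(x+1)`. -/
theorem cPow_cancel {m x : ℕ} (hm : 2 ≤ m) (hxm : x + 1 < m) :
    4 * cPow m (x + 1) * beta (cyc m) (2 ^ (x + 1)) * (1 - 2 * beta (cyc m) (2 ^ (x + 1))) =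
      -(2 * cPow m x * beta (cyc m) (2 ^ x) ^ 2) := by
  have h1 := cPow_mul_beta_sq hm hxm
  have h2 := cPow_mul_beta_sq hm (show x < m by omega)
  have hs : secProd (cyc m) (x + 1) =
      secProd (cyc m) x * (Real.cos (phi (cyc m) (2 ^ (x + 1))))⁻¹ := by
    unfold secProd
    rw [Finset.prod_Icc_succ_top (by omega)]
  have hc := cos_phi_two_pow_pos (show 1 ≤ x + 1 by omega) hxm
  rw [one_sub_two_mul_beta hm hxm]
  calc _ = -(8 * Real.cos (phi (cyc m) (2 ^ (x + 1))) *
        (cPow m (x + 1) * beta (cyc m) (2 ^ (x + 1)) ^ 2)) := by ring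
    _ = -(2 * (cPow m x * beta (cyc m) (2 ^ x) ^ 2)) := by
      rw [h1, h2, hs, pow_succ (2 : ℝ) x]; field_simp; ring
    _ = _ := by ring

/-- As `2^m ≡ -1` modulo `n`, the last stabilizing relation contributes to the nearest-neighbour
correlation; `c_1` is the value for which that correlation gets the right coefficient. -/
theorem cPow_normalization {m : ℕ} (hm : 2 ≤ m) :
    alphaBar (cyc m) ^ 2 * (4 * cPow m 0 * beta (cyc m) 1 * (1 - 2 * beta (cyc m) 1) +
      2 * cPow m (m - 1) * beta (cyc m) (2 ^ (m - 1)) ^ 2) = 1 := by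
  have h1 := cPow_mul_beta_sq hm (show m - 1 < m by omega)
  have hd := (cOne_denominator_pos hm).ne'
  have ha := alphaBar_ne_zero (five_le_cyc hm)
  obtain ⟨r, rfl⟩ : ∃ r, m = r + 2 := ⟨m - 2, by omega⟩
  have e1 : 2 * (r + 2) - 3 = 2 * r + 1 := by omega
  have e2 : 2 * (r + 2) - 1 = 2 * r + 3 := by omega
  have e3 : r + 2 - 1 = r + 1 := by omega
  rw [cPow_zero hm, mul_assoc 2 (cPow _ _), h1]
  rw [e2] at hd
  unfold cOne
  rw [e1, e2]
  rw [e3] at hd ⊢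
  set A := alphaBar (cyc (r + 2))
  set b := beta (cyc (r + 2)) 1
  set s := secProd (cyc (r + 2)) (r + 1)
  set d := 2 ^ (2 * r + 3) * b * (1 - 2 * b) + b ^ 2 * s with hdd
  calc _ = 1 / d * (2 ^ (2 * r + 3) * b * (1 - 2 * b)
        + (2 : ℝ) ^ (2 * r + 2) * (b / 2 ^ (r + 1)) ^ 2 * s) := by
        field_simp; ring
    _ = 1 / d * d := by
        rw [hdd]; congr 1; rw [div_pow, ← pow_mul, show (r + 1) * 2 = 2 * r + 2 by ring]
        field_simp
    _ = 1 := by field_simp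

/-! ### The sum-of-squares identity for cyclic families of vectors -/

/-- The image of `ψ` under the stabilizing operator
`ᾱ ((1 - 2 β_k) A_{i+k} + β_k (A_{i+2k} + A_i))`, `k = 2^x`, in terms of `a i = A_i ψ`. -/
def stab {V : Type*} [AddCommGroup V] [Module ℝ V] (m : ℕ) (a : ZMod (cyc m) → V) (x : ℕ)
    (i : ZMod (cyc m)) : V :=
  alphaBar (cyc m) • ((1 - 2 * beta (cyc m) (2 ^ x)) • a (i + 2 ^ x) +
    beta (cyc m) (2 ^ x) • (a (i + 2 * 2 ^ x) + a i))

section SumOfSquares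

variable {E : Type*} [NormedAddCommGroup E] [InnerProductSpace ℝ E]

/-- The total correlation at distance `k` of a cyclic family of vectors. -/
def corr {n : ℕ} [NeZero n] (a : ZMod n → E) (k : ZMod n) : ℝ := ∑ i, inner ℝ (a i) (a (i + k))

theorem corr_neg {n : ℕ} [NeZero n] (a : ZMod n → E) (k : ZMod n) : corr a (-k) = corr a k := by
  unfold corr
  rw [← Equiv.sum_comp (Equiv.addRight k)]
  refine Finset.sum_congr rfl fun i _ => ?_
  simp [real_inner_comm]

theorem norm_sub_smul_sq (ψ u v w : E) (A b : ℝ) :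
    ‖ψ - A • ((1 - 2 * b) • v + b • (w + u))‖ ^ 2 =
      ‖ψ‖ ^ 2 - 2 * A * ((1 - 2 * b) * inner ℝ ψ v + b * (inner ℝ ψ w + inner ℝ ψ u)) +
      A ^ 2 * ((1 - 2 * b) ^ 2 * inner ℝ v v + b ^ 2 * (inner ℝ w w + inner ℝ u u) +
        2 * b * (1 - 2 * b) * (inner ℝ v w + inner ℝ u v) + 2 * b ^ 2 * inner ℝ u w) := by
  simp only [← real_inner_self_eq_norm_sq, inner_add_left, inner_add_right, inner_sub_left,
    inner_sub_right, real_inner_smul_left, real_inner_smul_right]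
  rw [real_inner_comm ψ v, real_inner_comm ψ w, real_inner_comm ψ u, real_inner_comm v w,
    real_inner_comm u v, real_inner_comm u w]
  ring

theorem sum_norm_sub_stab_sq (m : ℕ) (a : ZMod (cyc m) → E) (ψ : E) (hψ : ‖ψ‖ = 1) (x : ℕ) :
    ∑ i, ‖ψ - stab m a x i‖ ^ 2 =
      (cyc m : ℝ) - 2 * alphaBar (cyc m) * ∑ i, inner ℝ ψ (a i) +
      alphaBar (cyc m) ^ 2 * (
        (1 - 4 * beta (cyc m) (2 ^ x) + 6 * beta (cyc m) (2 ^ x) ^ 2) * ∑ i, ‖a i‖ ^ 2 +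
        4 * beta (cyc m) (2 ^ x) * (1 - 2 * beta (cyc m) (2 ^ x)) * corr a (2 ^ x) +
        2 * beta (cyc m) (2 ^ x) ^ 2 * corr a (2 ^ (x + 1))) := by
  have shift (f : ZMod (cyc m) → ℝ) (k : ZMod (cyc m)) : ∑ i, f (i + k) = ∑ i, f i :=
    Equiv.sum_comp (Equiv.addRight k) f
  have h1 : ∑ i, inner ℝ (a (i + 2 ^ x)) (a (i + 2 * 2 ^ x)) = corr a (2 ^ x) := by
    rw [corr, ← shift (fun i => inner ℝ (a i) (a (i + 2 ^ x))) (2 ^ x)]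
    exact Finset.sum_congr rfl fun i _ => by rw [two_mul, add_assoc]
  have h2 : ∑ i, inner ℝ (a i) (a (i + 2 * 2 ^ x)) = corr a (2 ^ (x + 1)) := by
    rw [corr, pow_succ, mul_comm]
  simp only [stab, norm_sub_smul_sq, Finset.sum_add_distrib, Finset.sum_sub_distrib,
    ← Finset.mul_sum, real_inner_self_eq_norm_sq]
  rw [h1, h2, shift (fun i => inner ℝ ψ (a i)), shift (fun i => inner ℝ ψ (a i)),
    shift (fun i => ‖a i‖ ^ 2), shift (fun i => ‖a i‖ ^ 2),
    show ∑ i, inner ℝ (a i) (a (i + 2 ^ x)) = corr a (2 ^ x) from rfl]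
  simp [hψ, ZMod.card]
  ring

theorem sum_cPow_corr {m : ℕ} (hm : 2 ≤ m) (a : ZMod (cyc m) → E) {N : ℕ} (hN : N < m) :
    ∑ x ∈ Finset.range (N + 1), cPow m x *
        (4 * beta (cyc m) (2 ^ x) * (1 - 2 * beta (cyc m) (2 ^ x)) * corr a (2 ^ x) +
          2 * beta (cyc m) (2 ^ x) ^ 2 * corr a (2 ^ (x + 1))) =
      4 * cPow m 0 * beta (cyc m) 1 * (1 - 2 * beta (cyc m) 1) * corr a 1 +
        2 * cPow m N * beta (cyc m) (2 ^ N) ^ 2 * corr a (2 ^ (N + 1)) := by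
  induction N with
  | zero => simp; ring
  | succ N ih =>
    rw [Finset.sum_range_succ, ih (by omega)]
    linear_combination corr a (2 ^ (N + 1)) * cPow_cancel hm hN

/-- The weight of the terms `1 - ‖A_i ψ‖²` in the sum-of-squares decomposition. -/
def defectWeight (m : ℕ) : ℝ :=
  alphaBar (cyc m) ^ 2 * ∑ x ∈ Finset.range m, cPow m x *
    (1 - 4 * beta (cyc m) (2 ^ x) + 6 * beta (cyc m) (2 ^ x) ^ 2)

theorem defectWeight_pos {m : ℕ} (hm : 2 ≤ m) : 0 < defectWeight m := by
  have ha := alphaBar_ne_zero (five_le_cyc hm)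
  apply mul_pos (by positivity)
  apply Finset.sum_pos
  · intro x hx
    apply mul_pos (cPow_pos hm (Finset.mem_range.1 hx))
    -- `6 b² - 4 b + 1` has its minimum `1 / 3` at `b = 1 / 3`
    nlinarith [sq_nonneg (3 * beta (cyc m) (2 ^ x) - 1)]
  · exact ⟨0, Finset.mem_range.2 (by omega)⟩

/-- The sum-of-squares decomposition of `η_n - B_n`, written for the vectors `a i = A_i ψ`. -/
theorem sum_of_squares {m : ℕ} (hm : 2 ≤ m) (a : ZMod (cyc m) → E) (ψ : E) (hψ : ‖ψ‖ = 1) :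
    eta m - (-corr a 1 - gam m * ∑ i, inner ℝ ψ (a i)) =
      ∑ x ∈ Finset.range m, cPow m x * ∑ i, ‖ψ - stab m a x i‖ ^ 2 +
      defectWeight m * ∑ i, (1 - ‖a i‖ ^ 2) := by
  have ha := alphaBar_ne_zero (five_le_cyc hm)
  have h1 := sum_cPow_corr hm a (show m - 1 < m by omega)
  rw [show m - 1 + 1 = m by omega] at h1
  -- `2^m = -1` in `ZMod n`, which closes the chain of doublings
  have h2 : corr a (2 ^ m) = corr a 1 := by
    have : (2 : ZMod (cyc m)) ^ m = -1 := by
      have := ZMod.natCast_self (cyc m)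
      rw [eq_neg_iff_add_eq_zero]
      exact_mod_cast this
    rw [this, corr_neg]
  have h3 := cPow_normalization hm
  have h4 : ∑ i, (1 - ‖a i‖ ^ 2) = (cyc m : ℝ) - ∑ i, ‖a i‖ ^ 2 := by
    simp [Finset.sum_sub_distrib, ZMod.card]
  have h5 : ∑ x ∈ Finset.range m, cPow m x * ∑ i, ‖ψ - stab m a x i‖ ^ 2 =
      ((cyc m : ℝ) - 2 * alphaBar (cyc m) * ∑ i, inner ℝ ψ (a i)) *
          ∑ x ∈ Finset.range m, cPow m x +
        defectWeight m * ∑ i, ‖a i‖ ^ 2 + alphaBar (cyc m) ^ 2 *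
        ∑ x ∈ Finset.range m, cPow m x *
        (4 * beta (cyc m) (2 ^ x) * (1 - 2 * beta (cyc m) (2 ^ x)) * corr a (2 ^ x) +
          2 * beta (cyc m) (2 ^ x) ^ 2 * corr a (2 ^ (x + 1))) := by
    simp only [defectWeight, Finset.mul_sum (Finset.range m), Finset.sum_mul (Finset.range m),
      ← Finset.sum_add_distrib]
    refine Finset.sum_congr rfl fun x _ => ?_
    rw [sum_norm_sub_stab_sq m a ψ hψ x]
    ring
  have h6 : eta m = (cyc m : ℝ) * ∑ x ∈ Finset.range m, cPow m x +
      (cyc m : ℝ) * defectWeight m := by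
    simp only [eta, defectWeight, Finset.mul_sum (Finset.range m), ← Finset.sum_add_distrib]
    refine Finset.sum_congr rfl fun x _ => ?_
    field_simp
    ring
  rw [h5, h1, h2, h4, h6, gam]
  linear_combination (-corr a 1) * h3

end SumOfSquares

/-! ### The sum-of-squares decomposition of `η_n - B̃_n` -/

section Decomposition

variable {H : Type*} [NormedAddCommGroup H] [InnerProductSpace ℂ H] [CompleteSpace H]

theorem inner_star_mul_apply (A B : H →L[ℂ] H) (x : H) :
    inner ℂ x ((star A * B) x) = inner ℂ (A x) (B x) := by
  rw [ContinuousLinearMap.star_eq_adjoint]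
  exact ContinuousLinearMap.adjoint_inner_right A x (B x)

theorem inner_star_mul_self_apply_re (A : H →L[ℂ] H) (x : H) :
    (inner ℂ x ((star A * A) x)).re = ‖A x‖ ^ 2 := by
  rw [inner_star_mul_apply]
  exact inner_self_eq_norm_sq (𝕜 := ℂ) (A x)

namespace BinaryMeasurement

variable (M : BinaryMeasurement H)

theorem isSelfAdjoint_effect : star M.effect = M.effect := by simp [effect]

theorem isSelfAdjoint_obs : star M.obs = M.obs := by
  simp [obs, isSelfAdjoint_effect]

theorem obs_apply (x : H) : M.obs x = (2 : ℂ) • M.effect x - x := by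
  simp [obs]

variable {M}

theorem IsLuders.isPositive (h : M.IsLuders) : M.K.IsPositive := by
  rw [← ContinuousLinearMap.nonneg_iff_isPositive, h]
  exact CFC.sqrt_nonneg _

theorem IsLuders.star_K (h : M.IsLuders) : star M.K = M.K := h.isPositive.isSelfAdjoint

theorem IsLuders.effect_apply (h : M.IsLuders) (x : H) : M.effect x = M.K (M.K x) := by
  rw [effect, h.star_K]; rfl

theorem IsLuders.inner_K (h : M.IsLuders) (x y : H) :
    inner ℂ (M.K x) y = inner ℂ x (M.K y) := by
  conv_rhs => rw [← h.star_K, ContinuousLinearMap.star_eq_adjoint]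
  exact (ContinuousLinearMap.adjoint_inner_right _ _ _).symm

/-- `1 - A² = 4 K (1 - F) K`, so that the defect of `A² = 1` in a state measures how far the
post-measurement vector `K ψ` is from being certain to give the outcome `+1` again. -/
theorem IsLuders.norm_sq_sub_norm_obs_sq (h : M.IsLuders) (x : H) :
    ‖x‖ ^ 2 - ‖M.obs x‖ ^ 2 = 4 * ‖M.K' (M.K x)‖ ^ 2 := by
  have hc : ‖M.K (M.K x)‖ ^ 2 + ‖M.K' (M.K x)‖ ^ 2 = ‖M.K x‖ ^ 2 := by
    rw [← inner_star_mul_self_apply_re, ← inner_star_mul_self_apply_re, ← Complex.add_re,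
      ← inner_add_right, ← add_apply, M.complete]
    exact inner_self_eq_norm_sq (𝕜 := ℂ) _
  have h1 : (inner ℂ (M.effect x) x).re = ‖M.K x‖ ^ 2 := by
    rw [h.effect_apply, h.inner_K]
    exact inner_self_eq_norm_sq (𝕜 := ℂ) _
  have h2 := norm_sub_sq (𝕜 := ℂ) ((2 : ℂ) • M.effect x) x
  rw [← M.obs_apply, inner_smul_left, norm_smul] at h2
  have h3 : RCLike.re ((starRingEnd ℂ) 2 * inner ℂ (M.effect x) x) =
      2 * (inner ℂ (M.effect x) x).re := by
    simp
  rw [h3, h1, h.effect_apply] at h2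
  norm_num at h2
  rw [h2]
  linear_combination (-4) * hc

end BinaryMeasurement

theorem value_eq (m : ℕ) (M : ZMod (cyc m) → BinaryMeasurement H) (ψ : H) :
    value m M ψ = -(∑ i, (inner ℂ ((M i).obs ψ) ((M (i + 1)).obs ψ)).re)
      - gam m * ∑ i, (inner ℂ ψ ((M i).obs ψ)).re
      - ∑ i, ‖(M i).K ((M (i + 1)).K ψ)‖ ^ 2 - ∑ i, ‖(M i).K ((M (i - 1)).K ψ)‖ ^ 2 := by
  have h1 (i j : ZMod (cyc m)) :
      (inner ℂ ψ (((M i).obs * (M j).obs + (M j).obs * (M i).obs) ψ)).re =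
        2 * (inner ℂ ((M i).obs ψ) ((M j).obs ψ)).re := by
    rw [add_apply, inner_add_right, Complex.add_re]
    nth_rw 1 [← (M i).isSelfAdjoint_obs]
    nth_rw 2 [← (M j).isSelfAdjoint_obs]
    rw [inner_star_mul_apply, inner_star_mul_apply]
    have := inner_re_symm (𝕜 := ℂ) ((M i).obs ψ) ((M j).obs ψ)
    simp only [RCLike.re_eq_complex_re] at this
    rw [this]; ring
  have h2 (A B : H →L[ℂ] H) : (inner ℂ ψ ((star (A * B) * (A * B)) ψ)).re = ‖A (B ψ)‖ ^ 2 :=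
    inner_star_mul_self_apply_re (A * B) ψ
  simp only [value, opBTilde, opB, sub_apply, neg_apply,
    smul_apply, sum_apply, inner_sub_right, inner_neg_right,
    inner_smul_right, inner_sum, Complex.sub_re, Complex.neg_re, Complex.re_sum, h2,
    Complex.re_ofReal_mul]
  rw [show (1 / 2 : ℂ) = ((1 / 2 : ℝ) : ℂ) by norm_num, Complex.re_ofReal_mul, Complex.re_sum]
  simp only [h1, ← Finset.mul_sum]
  ring

/-- The sum-of-squares decomposition of `η_n - ⟨ψ| B̃_n |ψ⟩`. -/
theorem eta_sub_value {m : ℕ} (hm : 2 ≤ m) (M : ZMod (cyc m) → BinaryMeasurement H) (ψ : H)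
    (hM : ∀ i, (M i).IsLuders) (hψ : ‖ψ‖ = 1) :
    eta m - value m M ψ =
      ∑ x ∈ Finset.range m, cPow m x * ∑ i, ‖ψ - stab m (fun i => (M i).obs ψ) x i‖ ^ 2 +
      4 * defectWeight m * ∑ i, ‖(M i).K' ((M i).K ψ)‖ ^ 2 +
      ∑ i, ‖(M i).K ((M (i + 1)).K ψ)‖ ^ 2 + ∑ i, ‖(M i).K ((M (i - 1)).K ψ)‖ ^ 2 := by
  let _ : InnerProductSpace ℝ H := InnerProductSpace.rclikeToReal ℂ H
  have h := sum_of_squares hm (fun i => (M i).obs ψ) ψ hψ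
  have h1 : ∑ i, (1 - ‖(M i).obs ψ‖ ^ 2) = 4 * ∑ i, ‖(M i).K' ((M i).K ψ)‖ ^ 2 := by
    rw [Finset.mul_sum]
    refine Finset.sum_congr rfl fun i _ => ?_
    rw [← (hM i).norm_sq_sub_norm_obs_sq, hψ, one_pow]
  have h2 : corr (fun i => (M i).obs ψ) 1 =
      ∑ i, (inner ℂ ((M i).obs ψ) ((M (i + 1)).obs ψ)).re := rfl
  have h3 : ∑ i, inner ℝ ψ ((M i).obs ψ) = ∑ i, (inner ℂ ψ ((M i).obs ψ)).re := rfl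
  rw [h1, h2, h3] at h
  rw [value_eq]
  linear_combination h

theorem value_le_eta {m : ℕ} (hm : 2 ≤ m) (M : ZMod (cyc m) → BinaryMeasurement H) (ψ : H)
    (hM : ∀ i, (M i).IsLuders) (hψ : ‖ψ‖ = 1) : value m M ψ ≤ eta m := by
  rw [← sub_nonneg, eta_sub_value hm M ψ hM hψ]
  have := (defectWeight_pos hm).le
  have : 0 ≤ ∑ x ∈ Finset.range m, cPow m x *
      ∑ i, ‖ψ - stab m (fun i => (M i).obs ψ) x i‖ ^ 2 :=
    Finset.sum_nonneg fun x hx => mul_nonneg (cPow_pos hm (Finset.mem_range.1 hx)).le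
      (by positivity)
  positivity

/-- Equality in the sum-of-squares bound annihilates every square. Of the stabilizing relations,
only the one with `k = 1` is needed for self-testing, and of the two sequential orders only one. -/
theorem relations_of_value_eq_eta {m : ℕ} (hm : 2 ≤ m) (M : ZMod (cyc m) → BinaryMeasurement H)
    (ψ : H) (hM : ∀ i, (M i).IsLuders) (hψ : ‖ψ‖ = 1) (hv : value m M ψ = eta m)
    (i : ZMod (cyc m)) :
    stab m (fun i => (M i).obs ψ) 0 i = ψ ∧ (M i).K' ((M i).K ψ) = 0 ∧
      (M i).K ((M (i + 1)).K ψ) = 0 := by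
  have h := eta_sub_value hm M ψ hM hψ
  have hD := defectWeight_pos hm
  have e1 : 0 ≤ ∑ x ∈ Finset.range m, cPow m x *
      ∑ i, ‖ψ - stab m (fun i => (M i).obs ψ) x i‖ ^ 2 :=
    Finset.sum_nonneg fun x hx => mul_nonneg (cPow_pos hm (Finset.mem_range.1 hx)).le
      (by positivity)
  have e2 : 0 ≤ 4 * defectWeight m * ∑ i, ‖(M i).K' ((M i).K ψ)‖ ^ 2 := by positivity
  have e3 : 0 ≤ ∑ i, ‖(M i).K ((M (i + 1)).K ψ)‖ ^ 2 := by positivity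
  have e4 : 0 ≤ ∑ i, ‖(M i).K ((M (i - 1)).K ψ)‖ ^ 2 := by positivity
  have zero_of_sum (f : ZMod (cyc m) → H) (hf : ∑ i, ‖f i‖ ^ 2 = 0) : f i = 0 := by
    rw [Finset.sum_eq_zero_iff_of_nonneg (fun _ _ => by positivity)] at hf
    simpa using hf i (Finset.mem_univ i)
  have z1 : ∑ x ∈ Finset.range m, cPow m x *
      ∑ i, ‖ψ - stab m (fun i => (M i).obs ψ) x i‖ ^ 2 = 0 := by linarith
  have z2 : 4 * defectWeight m * ∑ i, ‖(M i).K' ((M i).K ψ)‖ ^ 2 = 0 := by linarith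
  refine ⟨?_, zero_of_sum (fun i => (M i).K' ((M i).K ψ)) ?_,
    zero_of_sum (fun i => (M i).K ((M (i + 1)).K ψ)) (by linarith)⟩
  · have h0 : (0 : ℕ) < m := by omega
    rw [Finset.sum_eq_zero_iff_of_nonneg (fun x hx =>
      mul_nonneg (cPow_pos hm (Finset.mem_range.1 hx)).le (by positivity))] at z1
    have := (mul_eq_zero.1 (z1 0 (Finset.mem_range.2 h0))).resolve_left (cPow_pos hm h0).ne'
    exact (sub_eq_zero.1
      (zero_of_sum (fun i => ψ - stab m (fun i => (M i).obs ψ) 0 i) this)).symm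
  · exact (mul_eq_zero.1 z2).resolve_left (by positivity)

end Decomposition

/-! ### The reference configuration attains `η_n` -/

theorem cos_theta_sq_eq {n : ℕ} (hn : 5 ≤ n) : 1 / (1 + 2 * alpha n) =
    Real.cos (Real.pi / n) / (1 + Real.cos (Real.pi / n)) := by
  have h := half_lt_cos hn
  have h2 := two_mul_alpha hn
  have h3 : 2 * alpha n = 1 / Real.cos (Real.pi / n) := by
    rw [eq_div_iff (by linarith)]; exact h2
  rw [h3]
  have : Real.cos (Real.pi / n) ≠ 0 := by linarith
  have : 1 + Real.cos (Real.pi / n) ≠ 0 := by linarith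
  field_simp
  ring

theorem cos_theta {n : ℕ} (hn : 5 ≤ n) : Real.cos (theta n) =
    Real.sqrt (Real.cos (Real.pi / n) / (1 + Real.cos (Real.pi / n))) := by
  have h := half_lt_cos hn
  unfold theta
  rw [cos_theta_sq_eq hn, Real.cos_arccos]
  · linarith [Real.sqrt_nonneg (Real.cos (Real.pi / n) / (1 + Real.cos (Real.pi / n)))]
  · refine Real.sqrt_le_one.2 ?_
    rw [div_le_one (by linarith)]
    linarith

theorem cos_theta_pos {n : ℕ} (hn : 5 ≤ n) : 0 < Real.cos (theta n) := by
  have h := half_lt_cos hn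
  rw [cos_theta hn]
  exact Real.sqrt_pos.2 (div_pos (by linarith) (by linarith))

theorem cos_theta_sq {n : ℕ} (hn : 5 ≤ n) :
    Real.cos (theta n) ^ 2 * (1 + Real.cos (Real.pi / n)) = Real.cos (Real.pi / n) := by
  have h := half_lt_cos hn
  rw [cos_theta hn, Real.sq_sqrt (div_nonneg (by linarith) (by linarith))]
  have : 1 + Real.cos (Real.pi / n) ≠ 0 := by linarith
  field_simp

theorem sin_theta_sq {n : ℕ} (hn : 5 ≤ n) :
    Real.sin (theta n) ^ 2 * (1 + Real.cos (Real.pi / n)) = 1 := by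
  rw [Real.sin_sq]
  linear_combination -cos_theta_sq hn

theorem sin_theta_pos {n : ℕ} (hn : 5 ≤ n) : 0 < Real.sin (theta n) := by
  have h1 : 0 ≤ Real.sin (theta n) := by
    apply Real.sin_nonneg_of_nonneg_of_le_pi
    · exact Real.arccos_nonneg _
    · exact Real.arccos_le_pi _
  refine lt_of_le_of_ne h1 fun h => ?_
  have := sin_theta_sq hn
  rw [← h] at this
  norm_num at this

/-- As `n - 1 = 2^m` is even, `φ_j` modulo `2π` depends on `j` modulo `n` only, so that `v̂_j` can
be evaluated at any representative of the index. -/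
theorem vHat_natCast {m : ℕ} (hm : 2 ≤ m) (j : ℕ) :
    vHat (cyc m) (j : ZMod (cyc m)) = !₂[(Real.cos (theta (cyc m)) : ℂ),
      (Real.sin (theta (cyc m)) * Real.sin (phi (cyc m) j) : ℝ),
      (Real.sin (theta (cyc m)) * Real.cos (phi (cyc m) j) : ℝ)] := by
  have hphi : phi (cyc m) j = phi (cyc m) (j % cyc m) +
      (2 ^ (m - 1) * (j / cyc m) : ℕ) * (2 * Real.pi) := by
    obtain ⟨r, rfl⟩ : ∃ r, m = r + 1 := ⟨m - 1, by omega⟩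
    have h : ((j : ℕ) : ℝ) = (cyc (r + 1) : ℕ) * (j / cyc (r + 1) : ℕ) + (j % cyc (r + 1) : ℕ) := by
      exact_mod_cast (Nat.div_add_mod j (cyc (r + 1))).symm
    have h' : ((cyc (r + 1) : ℕ) : ℝ) = 2 * 2 ^ r + 1 := by
      unfold cyc; push_cast; ring
    have h0 : (2 * 2 ^ r + 1 : ℝ) ≠ 0 := by positivity
    unfold phi
    rw [h, Nat.add_sub_cancel]
    generalize j / cyc (r + 1) = t
    generalize j % cyc (r + 1) = s
    rw [h']
    push_cast
    field_simp
    ring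
  rw [hphi, Real.sin_add_nat_mul_two_pi, Real.cos_add_nat_mul_two_pi]
  unfold vHat
  rw [ZMod.val_natCast]

theorem exists_natCast_eq {m : ℕ} (i : ZMod (cyc m)) : ∃ j : ℕ, (j : ZMod (cyc m)) = i :=
  ⟨i.val, ZMod.natCast_zmod_val i⟩

theorem inner_vHat {m : ℕ} (hm : 2 ≤ m) (j k : ℕ) :
    inner ℂ (vHat (cyc m) (j : ZMod (cyc m))) (vHat (cyc m) (k : ZMod (cyc m))) =
      ((Real.cos (theta (cyc m)) ^ 2 +
        Real.sin (theta (cyc m)) ^ 2 * Real.cos (phi (cyc m) k - phi (cyc m) j) : ℝ) : ℂ) := by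
  rw [vHat_natCast hm, vHat_natCast hm, EuclideanSpace.inner_eq_star_dotProduct, Real.cos_sub]
  simp [dotProduct, Fin.sum_univ_three, -Complex.ofReal_sin, -Complex.ofReal_cos]
  ring

theorem inner_vHat_self {m : ℕ} (hm : 2 ≤ m) (i : ZMod (cyc m)) :
    inner ℂ (vHat (cyc m) i) (vHat (cyc m) i) = 1 := by
  obtain ⟨j, rfl⟩ := exists_natCast_eq i
  rw [inner_vHat hm, sub_self, Real.cos_zero, mul_one, Real.cos_sq_add_sin_sq, Complex.ofReal_one]

theorem inner_vHat_succ {m : ℕ} (hm : 2 ≤ m) (i : ZMod (cyc m)) :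
    inner ℂ (vHat (cyc m) i) (vHat (cyc m) (i + 1)) = 0 := by
  obtain ⟨j, rfl⟩ := exists_natCast_eq i
  have h := inner_vHat hm j (j + 1)
  have hn := five_le_cyc hm
  have : Real.cos (theta (cyc m)) ^ 2 + Real.sin (theta (cyc m)) ^ 2 *
      Real.cos (phi (cyc m) 1) = 0 := by
    rw [cos_phi_one (cyc_ne_zero m)]
    have h1 := cos_theta_sq hn
    have h2 := sin_theta_sq hn
    linear_combination h1 - Real.cos (Real.pi / (cyc m : ℕ)) *
      Real.sin_sq_add_cos_sq (theta (cyc m))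
  rw [phi_add, add_sub_cancel_left, this] at h
  simpa using h

theorem inner_vHat_psiHat (n : ℕ) (i : ZMod n) :
    inner ℂ (vHat n i) psiHat = (Real.cos (theta n) : ℂ) := by
  rw [EuclideanSpace.inner_eq_star_dotProduct]
  simp [vHat, psiHat, dotProduct, Fin.sum_univ_three, -Complex.ofReal_sin, -Complex.ofReal_cos]

theorem norm_psiHat : ‖psiHat‖ = 1 := by
  simp [psiHat, EuclideanSpace.norm_eq, Fin.sum_univ_three]

theorem vHat_recurrence {m : ℕ} (hm : 2 ≤ m) (i : ZMod (cyc m)) (k : ℕ) :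
    vHat (cyc m) (i + 2 * k) + vHat (cyc m) i =
      (2 * Real.cos (phi (cyc m) k)) • vHat (cyc m) (i + k) +
      (2 * (1 - Real.cos (phi (cyc m) k)) * Real.cos (theta (cyc m))) • psiHat := by
  obtain ⟨j, rfl⟩ := exists_natCast_eq i
  have e1 : (j : ZMod (cyc m)) + 2 * k = ((j + k + k : ℕ) : ZMod (cyc m)) := by push_cast; ring
  have e2 : (j : ZMod (cyc m)) + k = ((j + k : ℕ) : ZMod (cyc m)) := by push_cast; ring
  have hs : Real.sin (phi (cyc m) j) = Real.sin (phi (cyc m) (j + k) - phi (cyc m) k) := by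
    rw [phi_add, add_sub_cancel_right]
  have hc : Real.cos (phi (cyc m) j) = Real.cos (phi (cyc m) (j + k) - phi (cyc m) k) := by
    rw [phi_add, add_sub_cancel_right]
  rw [e1, e2, vHat_natCast hm, vHat_natCast hm, vHat_natCast hm, phi_add _ (j + k), hs, hc,
    Real.sin_add, Real.cos_add, Real.sin_sub, Real.cos_sub, psiHat]
  ext l
  fin_cases l <;> simp [-Complex.ofReal_sin, -Complex.ofReal_cos] <;> ring

/-- The projective measurement with effect `|v̂_i⟩⟨v̂_i|`. -/
def refMeasurement {m : ℕ} (hm : 2 ≤ m) (i : ZMod (cyc m)) :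
    BinaryMeasurement (EuclideanSpace ℂ (Fin 3)) where
  K := InnerProductSpace.rankOne ℂ (vHat (cyc m) i) (vHat (cyc m) i)
  K' := 1 - InnerProductSpace.rankOne ℂ (vHat (cyc m) i) (vHat (cyc m) i)
  complete := by
    set R := InnerProductSpace.rankOne ℂ (vHat (cyc m) i) (vHat (cyc m) i) with hR
    have h1 : star R = R := (InnerProductSpace.isPositive_rankOne_self _).isSelfAdjoint
    have h2 : R * R = R := by
      ext1 z
      change R (R z) = R z
      rw [hR, InnerProductSpace.rankOne_apply,
        InnerProductSpace.rankOne_apply, inner_smul_right, inner_vHat_self hm, mul_one]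
    rw [star_sub, star_one, h1, h2, mul_sub, mul_one, sub_mul, one_mul, h2, sub_self, sub_zero,
      add_sub_cancel]

section Reference

variable {m : ℕ} (hm : 2 ≤ m) (i : ZMod (cyc m))

theorem refMeasurement_K_apply (z : EuclideanSpace ℂ (Fin 3)) :
    (refMeasurement hm i).K z = inner ℂ (vHat (cyc m) i) z • vHat (cyc m) i :=
  InnerProductSpace.rankOne_apply _ _ _

theorem refMeasurement_isLuders : (refMeasurement hm i).IsLuders := by
  have hp := InnerProductSpace.isPositive_rankOne_self (𝕜 := ℂ) (vHat (cyc m) i)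
  have h1 : star (refMeasurement hm i).K = (refMeasurement hm i).K := hp.isSelfAdjoint
  have h2 : 0 ≤ (refMeasurement hm i).K := (ContinuousLinearMap.nonneg_iff_isPositive _).2 hp
  rw [BinaryMeasurement.IsLuders, BinaryMeasurement.effect, h1, CFC.sqrt_mul_self _ h2]

theorem refMeasurement_obs_psiHat : (refMeasurement hm i).obs psiHat =
    (2 * Real.cos (theta (cyc m))) • vHat (cyc m) i - psiHat := by
  rw [BinaryMeasurement.obs_apply, (refMeasurement_isLuders hm i).effect_apply,
    refMeasurement_K_apply, refMeasurement_K_apply, inner_smul_right, inner_vHat_self hm,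
    inner_vHat_psiHat, mul_one, smul_smul, ← Complex.coe_smul]
  push_cast
  rfl

theorem stab_refMeasurement {x : ℕ} (hx : x < m) :
    stab m (fun i => (refMeasurement hm i).obs psiHat) x i = psiHat := by
  have hn := five_le_cyc hm
  have hr := vHat_recurrence hm i (2 ^ x)
  push_cast at hr
  have hb := two_mul_beta_mul hm hx
  have hc := half_lt_cos hn
  have hα : alphaBar (cyc m) * (2 * Real.cos (theta (cyc m)) ^ 2 - 1) = 1 := by
    have hc1 := cos_lt_one hn
    have h0 : Real.cos (Real.pi / (cyc m : ℕ)) - 1 ≠ 0 := by linarith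
    have h1 : 1 + Real.cos (Real.pi / (cyc m : ℕ)) ≠ 0 := by linarith
    have h2 : Real.cos (theta (cyc m)) ^ 2 =
        Real.cos (Real.pi / (cyc m : ℕ)) / (1 + Real.cos (Real.pi / (cyc m : ℕ))) := by
      rw [eq_div_iff h1]; exact cos_theta_sq hn
    rw [alphaBar_eq hn, h2]
    field_simp
    ring
  have hr' := eq_sub_of_add_eq hr
  simp only [stab, refMeasurement_obs_psiHat]
  rw [hr', one_sub_two_mul_beta hm hx]
  set t := Real.cos (theta (cyc m))
  set b := beta (cyc m) (2 ^ x)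
  set C := Real.cos (phi (cyc m) (2 ^ x))
  set A := alphaBar (cyc m)
  have hcoef : A * (2 * b * C + b * (2 * t * (2 * (1 - C) * t) - 2)) = 1 := by
    linear_combination hα + A * (2 * t ^ 2 - 1) * hb
  calc _ = (A * (2 * b * C + b * (2 * t * (2 * (1 - C) * t) - 2))) • psiHat := by module
    _ = psiHat := by rw [hcoef, one_smul]

theorem refMeasurement_K_succ : (refMeasurement hm i).K ((refMeasurement hm (i + 1)).K psiHat) = 0
    := by
  rw [refMeasurement_K_apply, refMeasurement_K_apply, inner_smul_right, inner_vHat_succ hm,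
    mul_zero, zero_smul]

theorem refMeasurement_K_pred : (refMeasurement hm i).K ((refMeasurement hm (i - 1)).K psiHat) = 0
    := by
  have h := inner_vHat_succ hm (i - 1)
  rw [sub_add_cancel] at h
  rw [refMeasurement_K_apply, refMeasurement_K_apply, inner_smul_right,
    inner_eq_zero_symm.1 h, mul_zero, zero_smul]

theorem refMeasurement_K'_K : (refMeasurement hm i).K' ((refMeasurement hm i).K psiHat) = 0 := by
  change (refMeasurement hm i).K psiHat -
    (refMeasurement hm i).K ((refMeasurement hm i).K psiHat) = 0
  rw [refMeasurement_K_apply, refMeasurement_K_apply, inner_smul_right, inner_vHat_self hm,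
    mul_one, sub_self]

theorem value_refMeasurement : value m (refMeasurement hm) psiHat = eta m := by
  have h := eta_sub_value hm (refMeasurement hm) psiHat (refMeasurement_isLuders hm) norm_psiHat
  have hs : ∑ x ∈ Finset.range m, cPow m x * ∑ i, ‖psiHat -
      stab m (fun i => (refMeasurement hm i).obs psiHat) x i‖ ^ 2 = 0 := by
    refine Finset.sum_eq_zero fun x hx => ?_
    simp [stab_refMeasurement hm _ (Finset.mem_range.1 hx)]
  simp only [refMeasurement_K_succ, refMeasurement_K_pred, refMeasurement_K'_K, norm_zero] at h
  rw [hs] at h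
  simp at h
  linarith

end Reference

theorem isGreatest_eta {m : ℕ} (hm : 2 ≤ m) : IsGreatest (quantumValues m) (eta m) := by
  constructor
  · exact ⟨3, refMeasurement hm, psiHat, refMeasurement_isLuders hm, norm_psiHat,
      value_refMeasurement hm⟩
  · rintro _ ⟨d, M, ψ, hM, hψ, rfl⟩
    exact value_le_eta hm M ψ hM hψ

/-! ### Rigidity: the relations of the optimum determine the configuration -/

section Rigidity

variable {H : Type*} [NormedAddCommGroup H] [InnerProductSpace ℂ H]

/-- The relations that hold at the maximum, for effects `F i` and the vectors `w i = F i ψ`. -/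
structure OptimalRelations (m : ℕ) (F : ZMod (cyc m) → H →L[ℂ] H) (w : ZMod (cyc m) → H) (ψ : H) :
    Prop where
  norm_eq : ‖ψ‖ = 1
  symm : ∀ i x y, inner ℂ (F i x) y = inner ℂ x (F i y)
  apply_state : ∀ i, F i ψ = w i
  apply_self : ∀ i, F i (w i) = w i
  apply_succ : ∀ i, F i (w (i + 1)) = 0
  recurrence : ∀ i, w (i + 2) + w i =
    ((2 * Real.cos (Real.pi / (cyc m : ℕ)) : ℝ) : ℂ) • (ψ - w (i + 1))

namespace OptimalRelations

variable {m : ℕ} {F : ZMod (cyc m) → H →L[ℂ] H} {w : ZMod (cyc m) → H} {ψ : H}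

theorem inner_succ (h : OptimalRelations m F w ψ) (i : ZMod (cyc m)) :
    inner ℂ (w i) (w (i + 1)) = 0 := by
  conv_lhs => rw [← h.apply_self i]
  rw [h.symm, h.apply_succ, inner_zero_right]

theorem inner_state_left (h : OptimalRelations m F w ψ) (i : ZMod (cyc m)) :
    inner ℂ ψ (w i) = inner ℂ (w i) (w i) := by
  conv_lhs => rw [← h.apply_self i]
  rw [← h.symm, h.apply_state]

theorem inner_state_right (h : OptimalRelations m F w ψ) (i : ZMod (cyc m)) :
    inner ℂ (w i) ψ = inner ℂ (w i) (w i) := by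
  conv_lhs => rw [← h.apply_self i]
  rw [h.symm, h.apply_state]

/-- Pairing the recurrence with its two outer vectors gives two values of
`⟪w (i + 2), w i⟫`; they agree only if the two outer vectors have the same norm. This is where
`2 cos (π / n) ≠ 1`, that is `n > 3`, is needed. -/
theorem inner_self_add_two (hm : 2 ≤ m) (h : OptimalRelations m F w ψ) (i : ZMod (cyc m)) :
    inner ℂ (w (i + 2)) (w (i + 2)) = inner ℂ (w i) (w i) := by
  have hc := half_lt_cos (five_le_cyc hm)
  have e : i + 1 + 1 = i + 2 := by rw [add_assoc, one_add_one_eq_two]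
  have h1 := congrArg (fun z => inner ℂ (w (i + 2)) z) (h.recurrence i)
  have h2 := congrArg (fun z => inner ℂ z (w i)) (h.recurrence i)
  have h3 := inner_eq_zero_symm.1 (h.inner_succ (i + 1))
  have h4 := inner_eq_zero_symm.1 (h.inner_succ i)
  rw [e] at h3
  simp only [inner_add_right, inner_add_left, inner_smul_right, inner_smul_left, inner_sub_right,
    inner_sub_left, h3, h4, h.inner_state_left, h.inner_state_right, Complex.conj_ofReal,
    sub_zero] at h1 h2
  have hne : (1 - ((2 * Real.cos (Real.pi / (cyc m : ℕ)) : ℝ) : ℂ)) ≠ 0 := by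
    rw [← Complex.ofReal_one, ← Complex.ofReal_sub, Complex.ofReal_ne_zero]
    linarith
  apply mul_left_cancel₀ hne
  linear_combination h1 - h2

theorem inner_self_succ (hm : 2 ≤ m) (h : OptimalRelations m F w ψ) (i : ZMod (cyc m)) :
    inner ℂ (w (i + 1)) (w (i + 1)) = inner ℂ (w i) (w i) := by
  have h1 (k : ℕ) : inner ℂ (w (i + 1 + 2 * k)) (w (i + 1 + 2 * k)) =
      inner ℂ (w (i + 1)) (w (i + 1)) := by
    induction k with
    | zero => simp
    | succ k ih =>
      rw [← ih, ← h.inner_self_add_two hm (i + 1 + 2 * k),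
        show i + 1 + 2 * ((k + 1 : ℕ) : ZMod (cyc m)) = i + 1 + 2 * k + 2 by push_cast; ring]
  -- `n` is odd: going around the cycle in steps of two reaches the preceding index
  have h2 : i + 1 + 2 * ((2 ^ (m - 1) : ℕ) : ZMod (cyc m)) = i := by
    have h3 : (((2 * 2 ^ (m - 1) + 1 : ℕ)) : ZMod (cyc m)) = 0 := by
      rw [← pow_succ', Nat.sub_add_cancel (by omega)]
      exact ZMod.natCast_self _
    push_cast at h3 ⊢
    linear_combination h3
  rw [← h1 (2 ^ (m - 1)), h2]

theorem inner_self (hm : 2 ≤ m) (h : OptimalRelations m F w ψ) (i : ZMod (cyc m)) :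
    inner ℂ (w i) (w i) = ((Real.cos (theta (cyc m)) ^ 2 : ℝ) : ℂ) := by
  have hc := half_lt_cos (five_le_cyc hm)
  have e : i + 1 + 1 = i + 2 := by rw [add_assoc, one_add_one_eq_two]
  have h1 := congrArg (fun z => inner ℂ ψ z) (h.recurrence i)
  have h2 := h.inner_self_succ hm i
  have h3 := h.inner_self_succ hm (i + 1)
  rw [e] at h3
  have hψ : inner ℂ ψ ψ = 1 := by rw [inner_self_eq_norm_sq_to_K, h.norm_eq]; simp
  simp only [inner_add_right, inner_smul_right, inner_sub_right, h.inner_state_left, h3, h2,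
    hψ] at h1
  have h4 : ((Real.cos (theta (cyc m)) ^ 2 * (1 + Real.cos (Real.pi / (cyc m : ℕ))) : ℝ) : ℂ) =
      (Real.cos (Real.pi / (cyc m : ℕ)) : ℝ) := by rw [cos_theta_sq (five_le_cyc hm)]
  have hne : (2 + ((2 * Real.cos (Real.pi / (cyc m : ℕ)) : ℝ) : ℂ)) ≠ 0 := by
    rw [show (2 : ℂ) = ((2 : ℝ) : ℂ) by norm_num, ← Complex.ofReal_add, Complex.ofReal_ne_zero]
    linarith
  apply mul_left_cancel₀ hne
  simp only [Complex.ofReal_mul, Complex.ofReal_add, Complex.ofReal_one, Complex.ofReal_ofNat]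
    at h1 h4 ⊢
  linear_combination h1 - 2 * h4

end OptimalRelations

end Rigidity

/-! ### Coordinates in three dimensions -/

section Frame

variable {H : Type*} [NormedAddCommGroup H] [InnerProductSpace ℂ H]

/-- Gram–Schmidt for `ψ, u₀, u₁`, where `u₀` and `u₁` are orthogonal to `ψ`, of length `s`, and at
an angle with cosine `C` and sine `S`; the order is that of the coordinates of `v̂_i`. -/
def frame (ψ u₀ u₁ : H) (s C S : ℝ) : Fin 3 → H :=
  ![ψ, ((s * S : ℝ) : ℂ)⁻¹ • (u₁ - (C : ℂ) • u₀), (s : ℂ)⁻¹ • u₀]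

theorem orthonormal_frame {ψ u₀ u₁ : H} {s C S : ℝ} (hs : s ≠ 0) (hS : S ≠ 0)
    (hCS : S ^ 2 + C ^ 2 = 1) (hψ : inner ℂ ψ ψ = 1) (h0 : inner ℂ ψ u₀ = 0)
    (h1 : inner ℂ ψ u₁ = 0) (h00 : inner ℂ u₀ u₀ = (s : ℂ) ^ 2) (h11 : inner ℂ u₁ u₁ = (s : ℂ) ^ 2)
    (h01 : inner ℂ u₀ u₁ = (s : ℂ) ^ 2 * C) : Orthonormal ℂ (frame ψ u₀ u₁ s C S) := by
  have h0' := inner_eq_zero_symm.1 h0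
  have h1' := inner_eq_zero_symm.1 h1
  have h10 : inner ℂ u₁ u₀ = (s : ℂ) ^ 2 * C := by
    rw [← inner_conj_symm, h01]; simp
  have hs' : (s : ℂ) ≠ 0 := by exact_mod_cast hs
  have hS' : (S : ℂ) ≠ 0 := by exact_mod_cast hS
  have hCS' : (S : ℂ) ^ 2 + (C : ℂ) ^ 2 = 1 := by exact_mod_cast hCS
  rw [orthonormal_iff_ite]
  intro i j
  fin_cases i <;> fin_cases j <;>
    simp [frame, inner_smul_left, inner_smul_right, inner_sub_left, inner_sub_right,
      h0, h1, h0', h1', h00, h01, h10, h11, hψ, -inner_self_eq_norm_sq_to_K,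
      -Complex.coe_smul] <;>
    try field_simp
  · linear_combination -hCS'
  all_goals simp [mul_comm]

/-- The isometric embedding of `ℂ³` that maps the standard basis to an orthonormal triple. -/
theorem exists_isometry_of_orthonormal {e : Fin 3 → H} (he : Orthonormal ℂ e) :
    ∃ L : EuclideanSpace ℂ (Fin 3) →ₗᵢ[ℂ] H, ∀ z, L z = z 0 • e 0 + z 1 • e 1 + z 2 • e 2 := by
  let b := EuclideanSpace.basisFun (Fin 3) ℂ
  let f := b.toBasis.constr ℂ e
  have hf : f ∘ b.toBasis = e := by
    funext i; simp [f]
  refine ⟨f.isometryOfOrthonormal (v := b.toBasis) (by simp)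
    (by rw [hf]; exact he), fun z => ?_⟩
  change f z = _
  simp [f, b, Module.Basis.constr_apply_fintype, Fin.sum_univ_three]

namespace OptimalRelations

variable {m : ℕ} {F : ZMod (cyc m) → H →L[ℂ] H} {w : ZMod (cyc m) → H} {ψ : H}

/-- The vectors `w i` lie in a three-dimensional space and have there, up to the factor `cos θ`, the
coordinates of `v̂_i`. -/
theorem exists_isometry (hm : 2 ≤ m) (h : OptimalRelations m F w ψ) :
    ∃ L : EuclideanSpace ℂ (Fin 3) →ₗᵢ[ℂ] H, L psiHat = ψ ∧
      ∀ i, w i = (Real.cos (theta (cyc m)) : ℂ) • L (vHat (cyc m) i) := by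
  have hn := five_le_cyc hm
  have ht := cos_theta_pos hn
  have hr := sin_theta_pos hn
  have hS := sin_phi_one_pos hn
  have hc := cos_phi_one (cyc_ne_zero m)
  have hCS := Real.sin_sq_add_cos_sq (phi (cyc m) 1)
  have htr := Real.sin_sq_add_cos_sq (theta (cyc m))
  have hts := cos_theta_sq hn
  have hphi (j : ℕ) := phi_add (cyc m) j 1
  have hrec (j : ℕ) := h.recurrence j
  have hself := h.inner_self hm
  have hv (j : ℕ) := vHat_natCast hm j
  set t := Real.cos (theta (cyc m))
  set r := Real.sin (theta (cyc m))
  set S := Real.sin (phi (cyc m) 1) with hSdef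
  set C := Real.cos (phi (cyc m) 1) with hCdef
  rw [show Real.cos (Real.pi / (cyc m : ℕ)) = -C by linarith] at hts
  rw [show Real.cos (Real.pi / (cyc m : ℕ)) = -C by linarith] at hrec
  have hts' : (t : ℂ) ^ 2 * (1 + -C) = -C := by exact_mod_cast hts
  have htr' : (r : ℂ) ^ 2 + (t : ℂ) ^ 2 = 1 := by exact_mod_cast htr
  have hψ : inner ℂ ψ ψ = 1 := by rw [inner_self_eq_norm_sq_to_K, h.norm_eq]; simp
  have h01 : inner ℂ (w 0) (w 1) = 0 := by simpa using h.inner_succ 0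
  have hl := h.inner_state_left
  have hrt := h.inner_state_right
  -- the component of `w i` orthogonal to `ψ`; in the plane of these components, `u 0` points along
  -- the third axis, as `φ_0 = 0`
  let u (i : ZMod (cyc m)) : H := w i - ((t ^ 2 : ℝ) : ℂ) • ψ
  have hu (i j : ZMod (cyc m)) : inner ℂ (u i) (u j) = inner ℂ (w i) (w j) - (t : ℂ) ^ 4 := by
    simp only [u, inner_sub_left, inner_sub_right, inner_smul_left, inner_smul_right, hl, hrt,
      hself, hψ, Complex.conj_ofReal]
    push_cast
    ring
  have hψu (i : ZMod (cyc m)) : inner ℂ ψ (u i) = 0 := by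
    simp only [u, inner_sub_right, inner_smul_right, hl, hself, hψ]
    ring
  have huu (i : ZMod (cyc m)) : inner ℂ (u i) (u i) = ((t * r : ℝ) : ℂ) ^ 2 := by
    rw [hu, hself]
    push_cast
    linear_combination (-(t : ℂ) ^ 2) * htr'
  have hu01 : inner ℂ (u 0) (u 1) = ((t * r : ℝ) : ℂ) ^ 2 * C := by
    rw [hu, h01]
    push_cast
    linear_combination (t : ℂ) ^ 2 * (-hts' - C * htr')
  have hs0 : t * r ≠ 0 := (mul_pos ht hr).ne'
  obtain ⟨L, hL⟩ := exists_isometry_of_orthonormal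
    (orthonormal_frame hs0 hS.ne' hCS hψ (hψu 0) (hψu 1) (huu 0) (huu 1) hu01)
  have he0 : frame ψ (u 0) (u 1) (t * r) C S 0 = ψ := rfl
  set e₁ := frame ψ (u 0) (u 1) (t * r) C S 1 with he1
  set e₂ := frame ψ (u 0) (u 1) (t * r) C S 2 with he2
  have hu0 : u 0 = ((t * r : ℝ) : ℂ) • e₂ := by
    rw [he2]
    change _ = ((t * r : ℝ) : ℂ) • ((t * r : ℝ) : ℂ)⁻¹ • u 0
    rw [smul_inv_smul₀ (by exact_mod_cast hs0)]
  have hu1 : u 1 = ((t * r : ℝ) : ℂ) • ((S : ℂ) • e₁ + (C : ℂ) • e₂) := by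
    have : ((t * r * S : ℝ) : ℂ) • e₁ = u 1 - (C : ℂ) • u 0 := by
      rw [he1]
      change ((t * r * S : ℝ) : ℂ) • ((t * r * S : ℝ) : ℂ)⁻¹ • _ = _
      rw [smul_inv_smul₀ (by exact_mod_cast mul_ne_zero hs0 hS.ne')]
    rw [smul_add, smul_comm _ (C : ℂ) e₂, ← hu0, smul_smul, ← Complex.ofReal_mul, this,
      sub_add_cancel]
  have hurec (j : ℕ) : u (j + 2) = ((2 * C : ℝ) : ℂ) • u (j + 1) - u j := by
    have := eq_sub_of_add_eq (hrec j)
    simp only [u]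
    rw [this]
    push_cast
    have hz : (-2 * ((t : ℂ) ^ 2 * (1 + -C) + C)) • ψ = 0 := by
      rw [hts', neg_add_cancel, mul_zero, zero_smul]
    rw [← sub_eq_zero, ← hz]
    module
  have key (j : ℕ) : u j = ((t * r : ℝ) : ℂ) • ((Real.sin (phi (cyc m) j) : ℂ) • e₁ +
        (Real.cos (phi (cyc m) j) : ℂ) • e₂) ∧
      u (j + 1) = ((t * r : ℝ) : ℂ) • ((Real.sin (phi (cyc m) (j + 1)) : ℂ) • e₁ +
        (Real.cos (phi (cyc m) (j + 1)) : ℂ) • e₂) := by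
    induction j with
    | zero => exact ⟨by simpa [phi] using hu0, by simpa [← hSdef, ← hCdef] using hu1⟩
    | succ j ih =>
      refine ⟨by simpa using ih.2, ?_⟩
      have e : ((j + 1 : ℕ) : ZMod (cyc m)) + 1 = j + 2 := by
        push_cast; rw [add_assoc, one_add_one_eq_two]
      -- the addition formula for the step `φ_1`, as a three-term recurrence
      have hsin : Real.sin (phi (cyc m) (j + 1 + 1)) =
          2 * C * Real.sin (phi (cyc m) (j + 1)) - Real.sin (phi (cyc m) j) := by
        rw [hphi, hphi, Real.sin_add, Real.sin_add, Real.cos_add, ← hSdef, ← hCdef]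
        linear_combination (-Real.sin (phi (cyc m) j)) * hCS
      have hcos : Real.cos (phi (cyc m) (j + 1 + 1)) =
          2 * C * Real.cos (phi (cyc m) (j + 1)) - Real.cos (phi (cyc m) j) := by
        rw [hphi, hphi, Real.cos_add, Real.sin_add, Real.cos_add, ← hSdef, ← hCdef]
        linear_combination (-Real.cos (phi (cyc m) j)) * hCS
      rw [e, hurec, ih.1, ih.2, hsin, hcos]
      push_cast
      module
  refine ⟨L, ?_, fun i => ?_⟩
  · rw [hL]
    simp [psiHat, he0]
  · obtain ⟨j, rfl⟩ := exists_natCast_eq i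
    have : w j = u j + ((t ^ 2 : ℝ) : ℂ) • ψ := by simp [u]
    rw [hL, hv, this, (key j).1, he0]
    generalize Real.sin (phi (cyc m) j) = a
    generalize Real.cos (phi (cyc m) j) = b
    simp
    module

end OptimalRelations

end Frame

/-! ### Effects at the optimum -/

namespace OptimalRelations

variable {H : Type*} [NormedAddCommGroup H] [InnerProductSpace ℂ H]
variable {m : ℕ} {F : ZMod (cyc m) → H →L[ℂ] H} {w : ZMod (cyc m) → H} {ψ : H}

/-- On the three-dimensional space, `F i` is the projection onto `w i`: it is known on `ψ`, `w i` and
`w (i + 1)`, and these vectors span because `sin φ_1 ≠ 0`. -/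
theorem apply_isometry (hm : 2 ≤ m) (h : OptimalRelations m F w ψ)
    (L : EuclideanSpace ℂ (Fin 3) →ₗᵢ[ℂ] H) (hLψ : L psiHat = ψ)
    (hL : ∀ i, w i = (Real.cos (theta (cyc m)) : ℂ) • L (vHat (cyc m) i)) (i : ZMod (cyc m))
    (z : EuclideanSpace ℂ (Fin 3)) :
    F i (L z) = (inner ℂ (vHat (cyc m) i) z : ℂ) • L (vHat (cyc m) i) := by
  obtain ⟨j, rfl⟩ := exists_natCast_eq i
  have hn := five_le_cyc hm
  have ht := cos_theta_pos hn
  have hr := sin_theta_pos hn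
  have hS := sin_phi_one_pos hn
  have hts := cos_theta_sq hn
  have htr := Real.sin_sq_add_cos_sq (theta (cyc m))
  have hc := cos_phi_one (cyc_ne_zero m)
  have hsc := Real.sin_sq_add_cos_sq (phi (cyc m) j)
  have hv := vHat_natCast hm j
  have hv' := vHat_natCast hm (j + 1)
  have hsin := Real.sin_add (phi (cyc m) j) (phi (cyc m) 1)
  have hcos := Real.cos_add (phi (cyc m) j) (phi (cyc m) 1)
  rw [← phi_add] at hsin hcos
  rw [hsin, hcos] at hv'
  have hψ := h.apply_state j
  have hw := h.apply_self j
  have hw' := h.apply_succ j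
  rw [← Nat.cast_succ] at hw'
  rw [hL] at hψ hw hw'
  rw [← hLψ] at hψ
  set t := Real.cos (theta (cyc m))
  set r := Real.sin (theta (cyc m))
  set S := Real.sin (phi (cyc m) 1)
  set C := Real.cos (phi (cyc m) 1)
  set s := Real.sin (phi (cyc m) j)
  set c := Real.cos (phi (cyc m) j)
  rw [show Real.cos (Real.pi / (cyc m : ℕ)) = -C by linarith] at hts
  have ht0 : (t : ℂ) ≠ 0 := by exact_mod_cast ht.ne'
  have hr0 : (r : ℂ) ≠ 0 := by exact_mod_cast hr.ne'
  have hS0 : (S : ℂ) ≠ 0 := by exact_mod_cast hS.ne'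
  have hts' : (t : ℂ) ^ 2 * (1 + -C) = -C := by exact_mod_cast hts
  have htr' : (r : ℂ) ^ 2 + (t : ℂ) ^ 2 = 1 := by exact_mod_cast htr
  have hsc' : (s : ℂ) ^ 2 + (c : ℂ) ^ 2 = 1 := by exact_mod_cast hsc
  let f₁ : EuclideanSpace ℂ (Fin 3) := !₂[0, 1, 0]
  let f₂ : EuclideanSpace ℂ (Fin 3) := !₂[0, 0, 1]
  let G : EuclideanSpace ℂ (Fin 3) →ₗ[ℂ] H := (F j : H →ₗ[ℂ] H) ∘ₗ L.toLinearMap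
  have hG (y) : F j (L y) = G y := rfl
  have expand (a b d : ℂ) : (!₂[a, b, d] : EuclideanSpace ℂ (Fin 3)) =
      a • psiHat + b • f₁ + d • f₂ := by
    ext l
    fin_cases l <;> simp [psiHat, f₁, f₂]
  set l := L (vHat (cyc m) (j : ZMod (cyc m)))
  have g0 : G psiHat = (t : ℂ) • l := hψ
  have gv : G (vHat (cyc m) (j : ZMod (cyc m))) = l := by
    rw [map_smul] at hw
    exact smul_right_injective H ht0 hw
  have gv' : G (vHat (cyc m) ((j + 1 : ℕ) : ZMod (cyc m))) = 0 := by
    rw [map_smul] at hw'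
    exact (smul_eq_zero.1 hw').resolve_left ht0
  rw [hv, expand, map_add, map_add, map_smul, map_smul, map_smul, g0] at gv
  rw [hv', expand, map_add, map_add, map_smul, map_smul, map_smul, g0] at gv'
  push_cast at gv gv'
  set x := G f₁
  set y := G f₂
  have q1 : (s : ℂ) • x + (c : ℂ) • y = (r : ℂ) • l := by
    apply smul_right_injective H hr0
    have e : ((r : ℂ) * r) • l = ((1 - (t : ℂ) * t)) • l := by congr 1; linear_combination htr'
    simp only [smul_smul, e, sub_smul, one_smul]
    rw [← sub_eq_zero, ← sub_eq_zero.2 gv]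
    module
  have q2 : ((s * C + c * S : ℂ)) • x + ((c * C - s * S : ℂ)) • y = ((r : ℂ) * C) • l := by
    apply smul_right_injective H hr0
    have e : ((r : ℂ) * (r * C)) • l = (-(t : ℂ) * t) • l := by
      congr 1; linear_combination C * htr' + hts'
    simp only [smul_smul, e]
    rw [← sub_eq_zero, ← gv']
    module
  have hx : x = ((r : ℂ) * s) • l := by
    have e : (-S * (s ^ 2 + c ^ 2) : ℂ) • x = (-S * (r * s) : ℂ) • l := by
      calc _ = (c * C - s * S : ℂ) • ((s : ℂ) • x + (c : ℂ) • y) -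
            (c : ℂ) • (((s * C + c * S : ℂ)) • x + ((c * C - s * S : ℂ)) • y) := by module
        _ = _ := by rw [q1, q2]; module
    rw [hsc', mul_one, mul_smul] at e
    exact smul_right_injective H (neg_ne_zero.2 hS0) e
  have hy : y = ((r : ℂ) * c) • l := by
    have e : (S * (s ^ 2 + c ^ 2) : ℂ) • y = (S * (r * c) : ℂ) • l := by
      calc _ = (s * C + c * S : ℂ) • ((s : ℂ) • x + (c : ℂ) • y) -
            (s : ℂ) • (((s * C + c * S : ℂ)) • x + ((c * C - s * S : ℂ)) • y) := by module
        _ = _ := by rw [q1, q2]; module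
    rw [hsc', mul_one, mul_smul] at e
    exact smul_right_injective H hS0 e
  have hz : z = !₂[z 0, z 1, z 2] := by
    ext l
    fin_cases l <;> rfl
  have hin : inner ℂ (vHat (cyc m) (j : ZMod (cyc m))) z = t * z 0 + r * s * z 1 + r * c * z 2 := by
    rw [hv, EuclideanSpace.inner_eq_star_dotProduct]
    simp [dotProduct, Fin.sum_univ_three, -Complex.ofReal_sin, -Complex.ofReal_cos]
    ring
  have hGz : G z = z 0 • (t : ℂ) • l + z 1 • x + z 2 • y := by
    conv_lhs => rw [hz]
    rw [expand, map_add, map_add, map_smul, map_smul, map_smul, g0]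
  rw [hG, hin, hGz, hx, hy]
  module

end OptimalRelations

/-- At the maximum `K_i ψ = F_i ψ`: the vector `K_i ψ` is fixed by `F_i = K_i²`, hence by the positive
operator `K_i`. -/
theorem optimalRelations_of_value_eq_eta {H : Type*} [NormedAddCommGroup H]
    [InnerProductSpace ℂ H] [CompleteSpace H] {m : ℕ} (hm : 2 ≤ m)
    (M : ZMod (cyc m) → BinaryMeasurement H) (ψ : H) (hM : ∀ i, (M i).IsLuders) (hψ : ‖ψ‖ = 1)
    (hv : value m M ψ = eta m) :
    OptimalRelations m (fun i => (M i).effect) (fun i => (M i).K ψ) ψ := by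
  have hrel := relations_of_value_eq_eta hm M ψ hM hψ hv
  have hfix (i : ZMod (cyc m)) : (M i).K ((M i).K ((M i).K ψ)) = (M i).K ψ := by
    have h1 : (star (M i).K * (M i).K + star (M i).K' * (M i).K') ((M i).K ψ) = (M i).K ψ := by
      rw [(M i).complete]; rfl
    have h2 : star (M i).K ((M i).K ((M i).K ψ)) + star (M i).K' ((M i).K' ((M i).K ψ)) =
      (M i).K ψ := h1
    rwa [(hrel i).2.1, map_zero, add_zero, (hM i).star_K] at h2
  have hK (i : ZMod (cyc m)) : (M i).K ((M i).K ψ) = (M i).K ψ := by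
    -- `z = K² ψ - K ψ` satisfies `K z = -z`
    have hz : (M i).K ((M i).K ((M i).K ψ) - (M i).K ψ) =
        -((M i).K ((M i).K ψ) - (M i).K ψ) := by
      rw [map_sub, hfix, neg_sub]
    have hp := (hM i).isPositive.re_inner_nonneg_right ((M i).K ((M i).K ψ) - (M i).K ψ)
    rw [hz, inner_neg_right, map_neg, inner_self_eq_norm_sq] at hp
    have : ‖(M i).K ((M i).K ψ) - (M i).K ψ‖ = 0 := by
      have := norm_nonneg ((M i).K ((M i).K ψ) - (M i).K ψ)
      nlinarith
    exact sub_eq_zero.1 (norm_eq_zero.1 this)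
  refine ⟨hψ, fun i x y => ?_, fun i => ?_, fun i => ?_, fun i => ?_, fun i => ?_⟩
  · rw [(hM i).effect_apply, (hM i).effect_apply, (hM i).inner_K, (hM i).inner_K]
  · rw [(hM i).effect_apply, hK]
  · rw [(hM i).effect_apply, hK, hK]
  · rw [(hM i).effect_apply, (hrel i).2.2, map_zero]
  · have hs := (hrel i).1
    have hn := five_le_cyc hm
    have hc := half_lt_cos hn
    have hc1 := cos_lt_one hn
    have hb := two_mul_beta_mul hm (show 0 < m by omega)
    rw [pow_zero, cos_phi_one (cyc_ne_zero m)] at hb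
    simp only [stab, BinaryMeasurement.obs_apply, (hM _).effect_apply, hK, pow_zero, mul_one] at hs
    have hA0 := alphaBar_eq hn
    set c := Real.cos (Real.pi / (cyc m : ℕ))
    set b := beta (cyc m) 1
    have hA : (1 - c) * alphaBar (cyc m) = -(1 + c) := by
      have : c - 1 ≠ 0 := by linarith
      rw [hA0]
      field_simp
      ring
    set u := (M (i + 1)).K ψ
    set v := (M (i + 2)).K ψ
    set w := (M i).K ψ
    have h1 := congrArg (fun z => ((1 - c) : ℝ) • z) hs
    simp only [smul_smul, hA] at h1
    have hb' : b = 1 / (2 * (1 + c)) := by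
      have : 1 + c ≠ 0 := by linarith
      field_simp; linarith
    have h2 : c • ((2 : ℝ) • u - ψ) + (v + w - ψ) = (c - 1) • ψ := by
      have : 1 + c ≠ 0 := by linarith
      have e1 : (1 + c) * (1 - 2 * b) = c := by rw [hb']; field_simp; ring
      have e2 : (1 + c) * b * 2 = 1 := by rw [hb']; field_simp
      calc _ = ((1 + c) * (1 - 2 * b)) • ((2 : ℝ) • u - ψ) + ((1 + c) * b * 2) • (v + w - ψ) := by
            rw [e1, e2, one_smul]
        _ = -(-(1 + c)) • ((1 - 2 * b) • ((2 : ℂ) • u - ψ) +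
              b • ((2 : ℂ) • v - ψ + ((2 : ℂ) • w - ψ))) := by module
        _ = -((1 - c) • ψ) := by rw [neg_smul, h1]
        _ = _ := by module
    rw [Complex.coe_smul, ← sub_eq_zero]
    rw [← sub_eq_zero] at h2
    rw [← h2]
    module

end KCBS

end

theorem mainTheorem5 (m : ℕ) (hm : 2 ≤ m) :
    IsGreatest (KCBS.quantumValues m) (KCBS.eta m) ∧
    ∀ (H : Type*) [NormedAddCommGroup H] [InnerProductSpace ℂ H] [FiniteDimensional ℂ H]
      [CompleteSpace H]
      (M : ZMod (KCBS.cyc m) → KCBS.BinaryMeasurement H) (ψ : H),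
      (∀ i, (M i).IsLuders) → ‖ψ‖ = 1 → KCBS.value m M ψ = KCBS.eta m →
      ∃ (P : H →L[ℂ] EuclideanSpace ℂ (Fin 3))
        (U : EuclideanSpace ℂ (Fin 3) →L[ℂ] EuclideanSpace ℂ (Fin 3)),
        P ∘L ContinuousLinearMap.adjoint P = ContinuousLinearMap.id ℂ (EuclideanSpace ℂ (Fin 3)) ∧
        U ∈ unitary (EuclideanSpace ℂ (Fin 3) →L[ℂ] EuclideanSpace ℂ (Fin 3)) ∧
        (∀ i, U ∘L (P ∘L (M i).obs ∘L ContinuousLinearMap.adjoint P) ∘L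
          ContinuousLinearMap.adjoint U = KCBS.obsHat (KCBS.cyc m) i) ∧
        U (P ψ) = KCBS.psiHat := by
  refine ⟨KCBS.isGreatest_eta hm, fun H _ _ _ _ M ψ hM hψ hv => ?_⟩
  have h := KCBS.optimalRelations_of_value_eq_eta hm M ψ hM hψ hv
  obtain ⟨L, hLψ, hLw⟩ := h.exists_isometry hm
  have hF := h.apply_isometry hm L hLψ hLw
  let T : EuclideanSpace ℂ (Fin 3) →L[ℂ] H := L.toContinuousLinearMap
  have hT (z) : ContinuousLinearMap.adjoint T (L z) = z := by
    refine ext_inner_left ℂ fun y => ?_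
    rw [ContinuousLinearMap.adjoint_inner_right]
    exact L.inner_map_map y z
  refine ⟨ContinuousLinearMap.adjoint T, 1, ?_, one_mem _, fun i => ?_, ?_⟩
  · rw [ContinuousLinearMap.adjoint_adjoint]
    ext1 z
    exact hT z
  · rw [ContinuousLinearMap.adjoint_adjoint, ← ContinuousLinearMap.star_eq_adjoint 1, star_one]
    ext1 z
    change ContinuousLinearMap.adjoint T ((M i).obs (L z)) = _
    rw [KCBS.BinaryMeasurement.obs_apply, hF, ← map_smul, ← map_smul, ← map_sub, hT]
    rfl
  · rw [← hLψ]
    exact hT _
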